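/- Let $B$ and $D$ be finite alphabets, $B$ non-empty, and let a discrete memoryless channel be given by transition probabilities $p(y|x)$, $x\in B$, $y\in D$, so that $p(y_1\ldots y_r|x_1\ldots x_r)=\prod_{i=1}^r p(y_i|x_i)$ for blocks of $r$ symbols. For a probability distribution $p$ on $B$ let $X$ be an input symbol with distribution $p$ and $Y$ the corresponding output symbol, and let $I(X:Y)=H(X)+H(Y)-H(X,Y)$ be their mutual information in bits. A block code consists of an encoding map $\mathcal C:B^m\to B^r$ and a decoding map $f:D^r\to B^m$; its rate is $\frac{m}{r}\log_2|B|$, and the error probability of a message $s\in B^m$ is the probability that $f$ applied to the channel output differs from $s$ when $\mathcal C(s)$ is sent. (Shannon II, Noisy Channel Coding Theorem.) (0) The maximum $C=\max_{p}I(X:Y)$ over all input distributions $p$ exists; $C$ is called the capacity of the channel. (1) Every rate $0\le R\le C$ is achievable: for all $\varepsilon,\delta>0$ there is $r_0$ such that for every $r\ge r_0$ there are $m<r$ with $\left|\frac{m}{r}\log_2|B|-R\right|<\delta$ and a block code with encoding map $B^m\to B^r$ for which every message in $B^m$ has error probability less than $\varepsilon$. (2) Conversely, let $R$ be a real number such that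 for all $\varepsilon,\delta>0$ there are $m\ge 0$, $r\ge 1$ with $\frac{m}{r}\log_2|B|>R-\delta$ and a block code with encoding map $B^m\to B^r$ whose error probability, averaged over uniformly distributed messages in $B^m$, is less than $\varepsilon$. Then $R\le C$. -/

import Mathlib

noncomputable section

/-- A discrete memoryless channel with finite input alphabet `B` and finite output alphabet `Y`,
given by its single-letter transition probabilities `prob x y`, i.e. `p(y|x)`. -/
structure MemorylessChannel (B Y : Type*) [Fintype Y] where
  prob : B → Y → ℝ
  prob_nonneg : ∀ x y, 0 ≤ prob x y
  sum_prob : ∀ x, ∑ y, prob x y = 1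

/-- Shannon entropy in bits of a probability vector (with `0 log 0 = 0`). -/
def shannonEntropy {S : Type*} [Fintype S] (p : S → ℝ) : ℝ :=
  -∑ s, p s * Real.logb 2 (p s)

/-- Mutual information in bits of a joint distribution `q` on `S × T`:
`I(X:Y) = H(X) - H(X,Y) + H(Y)`, the marginals being `p(x) = ∑ y, q (x, y)` and
`p(y) = ∑ x, q (x, y)`. -/
def mutualInformation {S T : Type*} [Fintype S] [Fintype T] (q : S × T → ℝ) : ℝ :=
  shannonEntropy (fun x => ∑ y, q (x, y)) - shannonEntropy q +
    shannonEntropy (fun y => ∑ x, q (x, y))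

namespace MemorylessChannel

/-- Joint distribution of input and output symbol when the input has distribution `p`. -/
def joint {B Y : Type*} [Fintype Y] (W : MemorylessChannel B Y) (p : B → ℝ) : B × Y → ℝ :=
  fun z => p z.1 * W.prob z.1 z.2

/-- The values `I(X:Y)` taken over all input distributions `p`. -/
def informationValues {B Y : Type*} [Fintype B] [Fintype Y] (W : MemorylessChannel B Y) : Set ℝ :=
  (fun p => mutualInformation (W.joint p)) '' stdSimplex ℝ B

/-- The capacity, in bits per channel symbol. -/
def capacity {B Y : Type*} [Fintype B] [Fintype Y] (W : MemorylessChannel B Y) : ℝ :=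
  sSup W.informationValues

/-- Transition probability of the block `y` given the block `x`: it factorises, since the channel
is memoryless. -/
def blockProb {B Y : Type*} [Fintype Y] (W : MemorylessChannel B Y) {r : ℕ}
    (x : Fin r → B) (y : Fin r → Y) : ℝ :=
  ∏ i, W.prob (x i) (y i)

end MemorylessChannel

/-- A block code `B^m → B^r`, together with a decoding function for the received blocks. -/
structure BlockCode (B Y : Type*) (m r : ℕ) where
  encode : (Fin m → B) → (Fin r → B)
  decode : (Fin r → Y) → (Fin m → B)

/-- The rate, in bits per channel symbol, of codes `B^m → B^r`: `(m / r) log₂ |B|`. -/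
def codeRate (B : Type*) [Fintype B] (m r : ℕ) : ℝ :=
  (m : ℝ) / (r : ℝ) * Real.logb 2 (Fintype.card B : ℝ)

namespace BlockCode

open Classical in
/-- Probability that the decoder does not return `s` when the message `s` was sent. -/
def errorProb {B Y : Type*} [Fintype Y] {m r : ℕ} (c : BlockCode B Y m r)
    (W : MemorylessChannel B Y) (s : Fin m → B) : ℝ :=
  ∑ y : Fin r → Y, if c.decode y = s then 0 else W.blockProb (c.encode s) y

/-- Error probability averaged over uniformly distributed messages. -/
def averageErrorProb {B Y : Type*} [Fintype B] [Fintype Y] {m r : ℕ} (c : BlockCode B Y m r)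
    (W : MemorylessChannel B Y) : ℝ :=
  (∑ s : Fin m → B, c.errorProb W s) / (Fintype.card B : ℝ) ^ m

end BlockCode

end

/-!
Shannon's noisy channel coding theorem, with an attained capacity, maximal error in the direct part
and average error in the converse. The mutual information is used throughout in the form
`I(X:Y) = ∑ p(x) D(W_x ‖ Q)`, where `W_x` is the output distribution for input `x` and `Q` the
output distribution for `p` (`mutualInformation_joint_mul_log_two`). It is continuous in `p`, so the
maximum over the compact simplex is attained.

Achievability needs no random code: by Feinstein's lemma (`exists_code_of_sum_le`) codewords can be
chosen greedily, each decoded on those outputs not yet claimed whose likelihood exceeds `θ` times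
their marginal probability. The choice goes on as long as the number of messages is small compared
to `θ` and the likelihood ratio is rarely below `θ`. For blocks of length `r` the logarithm of this
ratio is a sum of `r` independent terms of mean `I(X:Y)`, so for `θ = 2 ^ (b r)` with `b < C` the
second probability decays exponentially, by Chernoff's bound (`exists_sum_atypical_le`).

For the converse, let `Q` be the output distribution of an optimal input. Moving the optimal input
towards a point mass `x` cannot increase the information, and in the limit this gives
`D(W_x ‖ Q) ≤ C` for every `x` (`divergence_output_le_capacity`). Hence the output for any codeword
is within divergence `r C` of the fixed product distribution `Q ^ r`, under which the decoder
guesses one of `M` equiprobable messages correctly with probability `1 / M` only. Gibbs' inequality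
against a reweighting of `Q ^ r` that favours correct decoding
(`log_card_le_of_divergence_le`) then gives
`(1 - e) log M + e log η - η ≤ r C`, in nats, for the average error `e` and every `η > 0`. Since the block
length is not assumed to grow, `e → 0` is taken for a fixed `η`, and `η → 0` afterwards.
-/

/-! ### Sums over product distributions -/

theorem sum_pi_prod_eq_prod_sum {ι κ : Type*} [Fintype ι] [DecidableEq ι] [Fintype κ]
    (f : ι → κ → ℝ) : ∑ z : ι → κ, ∏ i, f i (z i) = ∏ i, ∑ k, f i k := by
  rw [Finset.prod_univ_sum, Fintype.piFinset_univ]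

/-- Under a product of probability vectors, the expectation of a function of one coordinate is its
expectation under the corresponding factor. -/
theorem sum_pi_prod_mul_apply {ι κ : Type*} [Fintype ι] [DecidableEq ι] [Fintype κ]
    (u : ι → κ → ℝ) (hu : ∀ i, ∑ k, u i k = 1) (j : ι) (h : κ → ℝ) :
    ∑ z : ι → κ, (∏ i, u i (z i)) * h (z j) = ∑ k, u j k * h k := by
  have e : ∀ z : ι → κ, (∏ i, u i (z i)) * h (z j) =
      ∏ i, u i (z i) * (if i = j then h (z i) else 1) := by
    intro z
    rw [Finset.prod_mul_distrib, Finset.prod_ite_eq' Finset.univ j (fun i => h (z i))]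
    simp
  simp_rw [e]
  rw [sum_pi_prod_eq_prod_sum (fun i k => u i k * (if i = j then h k else 1)),
    Finset.prod_eq_single j]
  · simp
  · intro i _ hij
    simp [hij, hu]
  · simp

theorem prod_mem_stdSimplex {B : Type*} [Fintype B] {p : B → ℝ} (hp : p ∈ stdSimplex ℝ B)
    (r : ℕ) :
    (fun x : Fin r → B => ∏ i, p (x i)) ∈ stdSimplex ℝ (Fin r → B) :=
  ⟨fun x => Finset.prod_nonneg fun i _ => hp.1 (x i), by
    rw [sum_pi_prod_eq_prod_sum (fun _ x => p x)]; simp [hp.2]⟩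

/-! ### Entropy -/

theorem shannonEntropy_mul_log_two {S : Type*} [Fintype S] (q : S → ℝ) :
    shannonEntropy q * Real.log 2 = -∑ s, q s * Real.log (q s) := by
  have h2 : Real.log 2 ≠ 0 := (Real.log_pos one_lt_two).ne'
  simp only [shannonEntropy, Real.logb, neg_mul, Finset.sum_mul]
  congr 1
  exact Finset.sum_congr rfl fun s _ => by field_simp

theorem continuous_shannonEntropy_comp {E S : Type*} [TopologicalSpace E] [Fintype S]
    {q : E → S → ℝ} (hq : ∀ s, Continuous fun e => q e s) :
    Continuous fun e => shannonEntropy (q e) := by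
  have h : Continuous fun x : ℝ => x * Real.logb 2 x := by
    simp only [Real.logb, ← mul_div_assoc]
    exact Real.continuous_mul_log.div_const _
  exact (continuous_finsetSum _ fun s _ => h.comp (hq s)).neg

/-- Pointwise form of Gibbs' inequality. -/
theorem mul_log_div_ge {a b : ℝ} (ha : 0 ≤ a) (hb : 0 ≤ b) (hab : 0 < a → 0 < b) :
    a - b ≤ a * Real.log (a / b) := by
  rcases ha.eq_or_lt with rfl | h
  · simpa using hb
  · have hb' := hab h
    have := Real.log_le_sub_one_of_pos (div_pos hb' h)
    rw [← inv_div a b, Real.log_inv, inv_div] at this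
    have h3 := mul_le_mul_of_nonneg_left this ha
    have : a * (b / a - 1) = b - a := by field_simp
    linarith

/-! ### Output distributions and divergences -/

namespace MemorylessChannel

variable {B Y : Type*} [Fintype Y]

/-- The distribution of the output symbol when the input has distribution `p`. -/
noncomputable def output [Fintype B] (W : MemorylessChannel B Y) (p : B → ℝ) (y : Y) : ℝ :=
  ∑ x, p x * W.prob x y

/-- The relative entropy, in nats, of the output distribution for input `x` with respect to `q`.
Where `q y = 0 < W.prob x y` the corresponding term is `0` instead of `∞`. -/
noncomputable def divergence (W : MemorylessChannel B Y) (x : B) (q : Y → ℝ) : ℝ :=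
  ∑ y, W.prob x y * Real.log (W.prob x y / q y)

/-- The channel that transmits blocks of `r` symbols. -/
noncomputable def block (W : MemorylessChannel B Y) (r : ℕ) :
    MemorylessChannel (Fin r → B) (Fin r → Y) where
  prob x y := W.blockProb x y
  prob_nonneg x y := Finset.prod_nonneg fun i _ => W.prob_nonneg (x i) (y i)
  sum_prob x := by
    simp only [blockProb]
    rw [sum_pi_prod_eq_prod_sum (fun i y => W.prob (x i) y)]
    simp [W.sum_prob]

theorem prob_pos_of_block_prob_ne_zero (W : MemorylessChannel B Y) {r : ℕ} {x : Fin r → B}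
    {z : Fin r → Y} (h : (W.block r).prob x z ≠ 0) (i : Fin r) : 0 < W.prob (x i) (z i) :=
  (W.prob_nonneg _ _).lt_of_ne'
    (Finset.prod_ne_zero_iff (s := Finset.univ) (f := fun i => W.prob (x i) (z i)).mp h i
      (Finset.mem_univ i))

variable [Fintype B] (W : MemorylessChannel B Y) {p : B → ℝ}

theorem output_nonneg (hp : p ∈ stdSimplex ℝ B) (y : Y) : 0 ≤ W.output p y :=
  Finset.sum_nonneg fun x _ => mul_nonneg (hp.1 x) (W.prob_nonneg x y)

theorem mul_prob_le_output (hp : p ∈ stdSimplex ℝ B) (x : B) (y : Y) :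
    p x * W.prob x y ≤ W.output p y :=
  Finset.single_le_sum (f := fun x => p x * W.prob x y)
    (fun x _ => mul_nonneg (hp.1 x) (W.prob_nonneg x y)) (Finset.mem_univ x)

theorem sum_output (hp : p ∈ stdSimplex ℝ B) : ∑ y, W.output p y = 1 := by
  simp only [output]
  rw [Finset.sum_comm]
  simp [← Finset.mul_sum, W.sum_prob, hp.2]

theorem output_block (p : B → ℝ) (r : ℕ) (y : Fin r → Y) :
    (W.block r).output (fun x => ∏ i, p (x i)) y = ∏ i, W.output p (y i) := by
  simp only [output, block, blockProb, ← Finset.prod_mul_distrib]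
  exact sum_pi_prod_eq_prod_sum (fun i x => p x * W.prob x (y i))

/-! ### Mutual information as a mean divergence -/

/-- `I(X:Y) = ∑ p(x) D(W_x ‖ q)`, where `q` is the output distribution. -/
theorem mutualInformation_joint_mul_log_two (hp : p ∈ stdSimplex ℝ B) :
    mutualInformation (W.joint p) * Real.log 2 = ∑ x, p x * W.divergence x (W.output p) := by
  have hx : ∀ x, ∑ y, W.joint p (x, y) = p x := fun x => by
    simp [joint, ← Finset.mul_sum, W.sum_prob]
  have hy : ∀ y, ∑ x, W.joint p (x, y) = W.output p y := fun y => rfl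
  simp only [mutualInformation, hx, hy, add_mul, sub_mul, shannonEntropy_mul_log_two]
  have e1 : ∑ x, p x * Real.log (p x) = ∑ x, ∑ y, p x * W.prob x y * Real.log (p x) := by
    refine Finset.sum_congr rfl fun x _ => ?_
    rw [← Finset.sum_mul, ← Finset.mul_sum, W.sum_prob, mul_one]
  have e2 : ∑ y, W.output p y * Real.log (W.output p y) =
      ∑ x, ∑ y, p x * W.prob x y * Real.log (W.output p y) := by
    rw [Finset.sum_comm]
    exact Finset.sum_congr rfl fun y _ => by rw [← Finset.sum_mul]; rfl
  rw [e1, e2, Fintype.sum_prod_type]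
  simp only [divergence, Finset.mul_sum, joint, ← Finset.sum_neg_distrib, ← Finset.sum_add_distrib,
    ← Finset.sum_sub_distrib]
  refine Finset.sum_congr rfl fun x _ => Finset.sum_congr rfl fun y _ => ?_
  rcases (mul_nonneg (hp.1 x) (W.prob_nonneg x y)).eq_or_lt with h | h
  · rw [← mul_assoc, ← h]; simp
  · have hQ := h.trans_le (W.mul_prob_le_output hp x y)
    have hne := mul_ne_zero_iff.mp h.ne'
    rw [Real.log_mul hne.1 hne.2, Real.log_div hne.2 hQ.ne']
    ring

/-- As `p(x) W_x ≤ Q` for the output distribution `Q`, the information is at most `∑ p log (1 / p)`,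
which Gibbs' inequality compares with the uniform distribution. -/
theorem mutualInformation_joint_le (hp : p ∈ stdSimplex ℝ B) :
    mutualInformation (W.joint p) ≤ Real.logb 2 (Fintype.card B) := by
  have h2 : 0 < Real.log 2 := Real.log_pos one_lt_two
  have hB : Nonempty B := by
    by_contra h
    rw [not_nonempty_iff] at h
    simpa using hp.2
  have hk : (0 : ℝ) < Fintype.card B := by exact_mod_cast Fintype.card_pos
  rw [Real.logb, le_div_iff₀ h2, W.mutualInformation_joint_mul_log_two hp]
  have key : ∀ x y, p x * (W.prob x y * Real.log (W.prob x y / W.output p y)) ≤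
      p x * W.prob x y * Real.log (Fintype.card B) +
        (W.prob x y / Fintype.card B - p x * W.prob x y) := by
    intro x y
    rcases (mul_nonneg (hp.1 x) (W.prob_nonneg x y)).eq_or_lt with h | h
    · rw [← mul_assoc, ← h]
      have := W.prob_nonneg x y
      simp only [zero_mul, sub_zero, zero_add]
      positivity
    · have hpW := mul_ne_zero_iff.mp h.ne'
      have hpx : 0 < p x := (hp.1 x).lt_of_ne' hpW.1
      have hW : 0 < W.prob x y := (W.prob_nonneg x y).lt_of_ne' hpW.2
      have hle := W.mul_prob_le_output hp x y
      have hQ := h.trans_le hle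
      have h1 : Real.log (W.prob x y / W.output p y) ≤ Real.log (1 / p x) := by
        apply Real.log_le_log (by positivity)
        rw [div_le_div_iff₀ hQ hpx]
        linarith
      have h3 := mul_log_div_ge hpx.le (b := 1 / Fintype.card B) (by positivity)
        (fun _ => by positivity)
      rw [div_div_eq_mul_div, div_one, Real.log_mul hpx.ne' hk.ne'] at h3
      rw [one_div, Real.log_inv] at h1
      have h4 := mul_le_mul_of_nonneg_left h1 h.le
      have h5 := mul_le_mul_of_nonneg_left h3 hW.le
      have h6 : W.prob x y / Fintype.card B = W.prob x y * (1 / Fintype.card B) := by ring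
      rw [h6]
      nlinarith
  calc ∑ x, p x * W.divergence x (W.output p)
      ≤ ∑ x, ∑ y, (p x * W.prob x y * Real.log (Fintype.card B) +
        (W.prob x y / Fintype.card B - p x * W.prob x y)) := by
        simp only [divergence, Finset.mul_sum]
        exact Finset.sum_le_sum fun x _ => Finset.sum_le_sum fun y _ => key x y
    _ = Real.log (Fintype.card B) := by
        simp only [Finset.sum_add_distrib, Finset.sum_sub_distrib, ← Finset.sum_mul,
          ← Finset.mul_sum, ← Finset.sum_div, W.sum_prob, hp.2, mul_one]
        simp [hk.ne']

/-- Replacing the output distribution by another distribution `q` can only increase the mean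
divergence, the difference being the divergence of the output distribution from `q`. -/
theorem sum_divergence_output_le (hp : p ∈ stdSimplex ℝ B) {q : Y → ℝ} (hq : ∀ y, 0 ≤ q y)
    (hq1 : ∑ y, q y = 1) (hac : ∀ y, 0 < W.output p y → 0 < q y) :
    ∑ x, p x * W.divergence x (W.output p) ≤ ∑ x, p x * W.divergence x q := by
  have key : ∀ y, W.output p y - q y ≤
      ∑ x, p x * (W.prob x y * Real.log (W.prob x y / q y)) -
      ∑ x, p x * (W.prob x y * Real.log (W.prob x y / W.output p y)) := by
    intro y
    refine (mul_log_div_ge (W.output_nonneg hp y) (hq y) (hac y)).trans_eq ?_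
    rw [← Finset.sum_sub_distrib]
    nth_rw 1 [output]
    rw [Finset.sum_mul]
    refine Finset.sum_congr rfl fun x _ => ?_
    rcases (mul_nonneg (hp.1 x) (W.prob_nonneg x y)).eq_or_lt with h | h
    · rw [← mul_assoc, ← mul_assoc, ← h]; simp
    · have hQ := h.trans_le (W.mul_prob_le_output hp x y)
      have hne := mul_ne_zero_iff.mp h.ne'
      rw [Real.log_div hQ.ne' (hac y hQ).ne', Real.log_div hne.2 (hac y hQ).ne',
        Real.log_div hne.2 hQ.ne']
      ring
  have := Finset.sum_le_sum fun y (_ : y ∈ Finset.univ) => key y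
  rw [Finset.sum_sub_distrib, Finset.sum_sub_distrib, W.sum_output hp, hq1, Finset.sum_comm,
    Finset.sum_comm (γ := Y)] at this
  simp only [divergence, Finset.mul_sum]
  linarith

/-! ### Existence of the capacity -/

theorem continuous_mutualInformation_joint :
    Continuous fun p : B → ℝ => mutualInformation (W.joint p) := by
  have hj : ∀ z, Continuous fun p : B → ℝ => W.joint p z := fun z => by
    unfold joint; fun_prop
  exact ((continuous_shannonEntropy_comp fun x => continuous_finsetSum _ fun y _ => hj (x, y)).sub (continuous_shannonEntropy_comp hj)).add
    (continuous_shannonEntropy_comp fun y => continuous_finsetSum _ fun x _ => hj (x, y))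

theorem isGreatest_capacity [Nonempty B] : IsGreatest W.informationValues W.capacity := by
  classical
  exact ((isCompact_stdSimplex ℝ B).image W.continuous_mutualInformation_joint).isGreatest_sSup
    (Set.Nonempty.image _ ⟨_, single_mem_stdSimplex ℝ (Classical.arbitrary B)⟩)

/-! ### The divergences from the optimal output distribution -/

/-- Moving an optimal input distribution `p` towards the point mass at `x` does not increase the
information, which bounds the divergence of `W_x` from the perturbed output distribution. -/
theorem divergence_perturb_le [Nonempty B] (hp : p ∈ stdSimplex ℝ B)
    (hC : mutualInformation (W.joint p) = W.capacity) (x : B) {t : ℝ} (ht : 0 < t) (ht1 : t < 1) :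
    W.divergence x (fun y => (1 - t) * W.output p y + t * W.prob x y) ≤
      W.capacity * Real.log 2 := by
  classical
  set p' : B → ℝ := (1 - t) • p + t • Pi.single x 1 with hp'
  have hp'm : p' ∈ stdSimplex ℝ B :=
    convex_stdSimplex ℝ B hp (single_mem_stdSimplex ℝ x) (by linarith) ht.le (by ring)
  have hsum : ∀ g : B → ℝ, ∑ z, p' z * g z = (1 - t) * ∑ z, p z * g z + t * g x := by
    intro g
    simp [hp', add_mul, Finset.sum_add_distrib, Finset.mul_sum, Pi.single_apply, mul_assoc]
  have hout : (fun y => (1 - t) * W.output p y + t * W.prob x y) = W.output p' := by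
    funext y
    exact (hsum fun z => W.prob z y).symm
  rw [hout]
  have h2 : 0 < Real.log 2 := Real.log_pos one_lt_two
  have h1 : mutualInformation (W.joint p') ≤ W.capacity :=
    W.isGreatest_capacity.2 ⟨p', hp'm, rfl⟩
  have h3 := mul_le_mul_of_nonneg_right h1 h2.le
  rw [W.mutualInformation_joint_mul_log_two hp'm, hsum fun z => W.divergence z (W.output p')] at h3
  have h4 := W.sum_divergence_output_le hp (W.output_nonneg hp'm) (W.sum_output hp'm) (fun y hy => by
    rw [← hout]
    have := W.prob_nonneg x y
    have : 0 < 1 - t := by linarith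
    positivity)
  rw [← W.mutualInformation_joint_mul_log_two hp, hC] at h4
  have h5 := mul_le_mul_of_nonneg_left h4 (by linarith : 0 ≤ 1 - t)
  have h6 : t * W.divergence x (W.output p') ≤ t * (W.capacity * Real.log 2) := by linarith
  exact le_of_mul_le_mul_left h6 ht

/-- An optimal input distribution reaches every output symbol that can be reached at all: otherwise
the bound on the perturbed divergences would fail, as one term of them grows like `log (1 / t)`. -/
theorem output_pos_of_prob_pos [Nonempty B] (hp : p ∈ stdSimplex ℝ B)
    (hC : mutualInformation (W.joint p) = W.capacity) {x : B} {y : Y} (hxy : 0 < W.prob x y) :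
    0 < W.output p y := by
  by_contra hQ
  have hQ0 : W.output p y = 0 := le_antisymm (not_lt.mp hQ) (W.output_nonneg hp y)
  set K := W.capacity * Real.log 2 - ∑ z, W.prob x z * Real.log (W.prob x z) with hK
  have hW1 : ∀ z, W.prob x z ≤ 1 := fun z => (W.sum_prob x) ▸
    Finset.single_le_sum (fun z _ => W.prob_nonneg x z) (Finset.mem_univ z)
  have hQ1 : ∀ z, W.output p z ≤ 1 := fun z => (W.sum_output hp) ▸
    Finset.single_le_sum (fun z _ => W.output_nonneg hp z) (Finset.mem_univ z)
  have bound : ∀ t : ℝ, 0 < t → t < 1 → W.prob x y * -Real.log (t * W.prob x y) ≤ K := by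
    intro t ht ht1
    have h := W.divergence_perturb_le hp hC x ht ht1
    have hterm : ∀ z, W.prob x z * Real.log (W.prob x z /
        ((1 - t) * W.output p z + t * W.prob x z)) = W.prob x z * Real.log (W.prob x z) +
        W.prob x z * -Real.log ((1 - t) * W.output p z + t * W.prob x z) := by
      intro z
      rcases (W.prob_nonneg x z).eq_or_lt with h0 | h0
      · rw [← h0]; simp
      · have : 0 < (1 - t) * W.output p z + t * W.prob x z := by
          have := mul_nonneg (by linarith : 0 ≤ 1 - t) (W.output_nonneg hp z)
          positivity
        rw [Real.log_div h0.ne' this.ne']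
        ring
    simp only [divergence, hterm, Finset.sum_add_distrib] at h
    have h1 := Finset.single_le_sum (f := fun z => W.prob x z *
        -Real.log ((1 - t) * W.output p z + t * W.prob x z)) (fun z _ => by
      refine mul_nonneg (W.prob_nonneg x z) (neg_nonneg.mpr (Real.log_nonpos ?_ ?_))
      · exact add_nonneg (mul_nonneg (by linarith) (W.output_nonneg hp z))
          (mul_nonneg ht.le (W.prob_nonneg x z))
      · have := mul_le_mul_of_nonneg_left (hQ1 z) (by linarith : 0 ≤ 1 - t)
        have := mul_le_mul_of_nonneg_left (hW1 z) ht.le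
        linarith) (Finset.mem_univ y)
    simp only [hQ0, mul_zero, zero_add] at h1
    linarith
  have hlim : Filter.Tendsto (fun t : ℝ => W.prob x y * -Real.log (t * W.prob x y))
      (nhdsWithin 0 (Set.Ioi 0)) Filter.atTop := by
    refine Filter.Tendsto.const_mul_atTop hxy (Filter.tendsto_neg_atBot_atTop.comp ?_)
    refine Real.tendsto_log_nhdsGT_zero.comp ?_
    refine tendsto_nhdsWithin_iff.mpr ⟨?_, ?_⟩
    · have : Continuous fun t : ℝ => t * W.prob x y := by fun_prop
      simpa using (this.tendsto 0).mono_left nhdsWithin_le_nhds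
    · filter_upwards [self_mem_nhdsWithin] with t ht
      exact mul_pos ht hxy
  obtain ⟨t, h1, h2⟩ := ((hlim.eventually_gt_atTop K).and
    (Ioo_mem_nhdsGT (zero_lt_one (α := ℝ)))).exists
  exact absurd (bound t h2.1 h2.2) (not_le.mpr h1)

/-- No input symbol is farther than the capacity from the optimal output distribution. -/
theorem divergence_output_le_capacity [Nonempty B] (hp : p ∈ stdSimplex ℝ B)
    (hC : mutualInformation (W.joint p) = W.capacity) (x : B) :
    W.divergence x (W.output p) ≤ W.capacity * Real.log 2 := by
  have hcont : ContinuousAt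
      (fun t : ℝ => W.divergence x (fun y => (1 - t) * W.output p y + t * W.prob x y)) 0 := by
    unfold divergence
    refine tendsto_finsetSum _ fun y _ => ?_
    rcases (W.prob_nonneg x y).eq_or_lt with h0 | h0
    · simp only [← h0, zero_mul]
      exact tendsto_const_nhds
    · have hQ := W.output_pos_of_prob_pos hp hC h0
      have : ContinuousAt (fun t : ℝ => W.prob x y *
          Real.log (W.prob x y / ((1 - t) * W.output p y + t * W.prob x y))) 0 := by
        refine continuousAt_const.mul (ContinuousAt.log ?_ ?_)
        · refine continuousAt_const.div (by fun_prop) ?_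
          simpa using hQ.ne'
        · simpa using ⟨h0.ne', hQ.ne'⟩
      exact this
  have h1 := hcont.tendsto.mono_left (nhdsWithin_le_nhds (s := Set.Ioi 0))
  simp only [sub_zero, one_mul, zero_mul, add_zero] at h1
  refine le_of_tendsto h1 ?_
  filter_upwards [Ioo_mem_nhdsGT (zero_lt_one (α := ℝ))] with t ht
  exact W.divergence_perturb_le hp hC x ht.1 ht.2

/-! ### Achievability -/


open Classical in
/-- **Feinstein's lemma.** If the likelihood of the output given the input typically exceeds its
marginal probability by a factor of more than `θ`, then a code with few messages compared to `θ` has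
small maximal error: codewords are chosen greedily, each one being decoded on the part of
its set of typical outputs that is still free. -/
theorem exists_code_of_sum_le {X Z ι : Type*} [Fintype X] [Fintype Z] (V : MemorylessChannel X Z)
    {p : X → ℝ} (hp : p ∈ stdSimplex ℝ X) {θ ε : ℝ} (hθ : 0 < θ) (T : Finset ι)
    (h : ∑ x, ∑ z, (if θ * V.output p z < V.prob x z then 0 else p x * V.prob x z) +
      T.card / θ ≤ ε) :
    ∃ (enc : ι → X) (dec : Z → Option ι),
      (∀ z s, dec z = some s → s ∈ T ∧ θ * V.output p z < V.prob (enc s) z) ∧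
      ∀ s ∈ T, ∑ z, (if dec z = some s then 0 else V.prob (enc s) z) ≤ ε := by
  have hX : Nonempty X := by
    by_contra hX
    rw [not_nonempty_iff] at hX
    simpa using hp.2
  induction T using Finset.induction_on with
  | empty => exact ⟨fun _ => Classical.arbitrary X, fun _ => none, by simp, by simp⟩
  | insert s₀ T hs₀ ih =>
    rw [Finset.card_insert_of_notMem hs₀, Nat.cast_add, Nat.cast_one] at h
    have hpos : 0 < 1 / θ := by positivity
    obtain ⟨enc, dec, hdec, herr⟩ := ih (by rw [add_div] at h; linarith)
    -- the outputs already claimed by the earlier codewords have total probability at most `|T| / θ`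
    have hQ : ∑ z, (if dec z = none then 0 else V.output p z) ≤ T.card / θ := by
      have h1 : ∀ z, (if dec z = none then 0 else V.output p z) ≤
          ∑ s ∈ T, V.prob (enc s) z / θ := by
        intro z
        have h0 : ∀ s ∈ T, 0 ≤ V.prob (enc s) z / θ := fun s _ =>
          div_nonneg (V.prob_nonneg _ _) hθ.le
        rcases hz : dec z with _ | s
        · simpa using Finset.sum_nonneg h0
        · simp only [reduceCtorEq, if_false]
          refine le_trans ?_ (Finset.single_le_sum h0 (hdec z s hz).1)
          rw [le_div_iff₀ hθ]
          linarith [(hdec z s hz).2]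
      refine (Finset.sum_le_sum fun z _ => h1 z).trans_eq ?_
      rw [Finset.sum_comm]
      simp only [← Finset.sum_div, V.sum_prob, Finset.sum_const, nsmul_eq_mul, mul_one]
    -- averaging over `p` gives a codeword that is rarely atypical or already claimed
    obtain ⟨x₀, hx₀⟩ : ∃ x, ∑ z, (if dec z = none ∧ θ * V.output p z < V.prob x z then 0
        else V.prob x z) ≤ ε := by
      by_contra! hcon
      have hlt : ε < ∑ x, p x * ∑ z, (if dec z = none ∧ θ * V.output p z < V.prob x z then 0
          else V.prob x z) := by
        have e1 : ε = ∑ x, p x * ε := by rw [← Finset.sum_mul, hp.2, one_mul]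
        rw [e1]
        obtain ⟨x, hx⟩ : ∃ x, 0 < p x := by
          by_contra! hle
          have : ∑ x, p x ≤ 0 := Finset.sum_nonpos fun x _ => hle x
          rw [hp.2] at this
          linarith
        refine Finset.sum_lt_sum (fun x _ => ?_) ⟨x, Finset.mem_univ x, ?_⟩
        · exact mul_le_mul_of_nonneg_left (hcon x).le (hp.1 x)
        · exact mul_lt_mul_of_pos_left (hcon x) hx
      have hle : ∑ x, p x * ∑ z, (if dec z = none ∧ θ * V.output p z < V.prob x z then 0
          else V.prob x z) ≤
          ∑ x, ∑ z, (if θ * V.output p z < V.prob x z then 0 else p x * V.prob x z) +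
          ∑ z, (if dec z = none then 0 else V.output p z) := by
        have e2 : ∑ z, (if dec z = none then 0 else V.output p z) =
            ∑ x, ∑ z, (if dec z = none then 0 else p x * V.prob x z) := by
          rw [Finset.sum_comm]
          refine Finset.sum_congr rfl fun z _ => ?_
          split_ifs
          · simp
          · rfl
        rw [e2, ← Finset.sum_add_distrib]
        refine Finset.sum_le_sum fun x _ => ?_
        rw [Finset.mul_sum, ← Finset.sum_add_distrib]
        refine Finset.sum_le_sum fun z _ => ?_
        have := mul_nonneg (hp.1 x) (V.prob_nonneg x z)
        by_cases c1 : dec z = none <;> by_cases c2 : θ * V.output p z < V.prob x z <;>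
          simp [c1, c2, this]
      rw [add_div] at h
      linarith
    refine ⟨Function.update enc s₀ x₀, fun z =>
      if dec z = none ∧ θ * V.output p z < V.prob x₀ z then some s₀ else dec z, ?_, ?_⟩
    · intro z s hz
      simp only at hz
      split_ifs at hz with hc
      · obtain rfl : s₀ = s := by simpa using hz
        simpa using hc.2
      · have := hdec z s hz
        have hne : s ≠ s₀ := fun e => hs₀ (e ▸ this.1)
        exact ⟨Finset.mem_insert_of_mem this.1, by simpa [Function.update_of_ne hne] using this.2⟩
    · intro s hs
      rcases Finset.mem_insert.mp hs with rfl | hs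
      · refine le_trans (Finset.sum_le_sum fun z _ => ?_) hx₀
        have := V.prob_nonneg x₀ z
        simp only [Function.update_self]
        by_cases c : dec z = none ∧ θ * V.output p z < V.prob x₀ z
        · simp [c]
        · simp only [c, if_false]
          split_ifs <;> simp [this]
      · have hne : s ≠ s₀ := fun e => hs₀ (e ▸ hs)
        refine (Finset.sum_le_sum fun z _ => ?_).trans (herr s hs)
        simp only [Function.update_of_ne hne]
        have := V.prob_nonneg (enc s) z
        by_cases c : dec z = some s
        · simp [c]
        · simp only [c, if_false]
          split_ifs <;> simp [this]

/-- The exponential moment in Chernoff's bound for the event that the information density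
`log (p(y|x) / p(y))` is less than `a`; it falls below `1` for small positive parameters, its
derivative at `0` being `a - I(X:Y)`. -/
theorem exists_exp_moment_lt_one (hp : p ∈ stdSimplex ℝ B) {a : ℝ}
    (ha : a < ∑ x, p x * W.divergence x (W.output p)) :
    ∃ t : ℝ, 0 < t ∧ ∑ x, ∑ y, p x * W.prob x y *
      Real.exp (t * (a - Real.log (W.prob x y / W.output p y))) < 1 := by
  set φ : ℝ → ℝ := fun t => ∑ x, ∑ y, p x * W.prob x y *
      Real.exp (t * (a - Real.log (W.prob x y / W.output p y))) with hφ
  have h0 : φ 0 = 1 := by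
    simp [hφ, ← Finset.mul_sum, W.sum_prob, hp.2]
  have hd : HasDerivAt φ (∑ x, ∑ y, p x * W.prob x y *
      (a - Real.log (W.prob x y / W.output p y))) 0 := by
    refine HasDerivAt.fun_sum fun x _ => HasDerivAt.fun_sum fun y _ => ?_
    have := (((hasDerivAt_id (0 : ℝ)).mul_const
      (a - Real.log (W.prob x y / W.output p y))).exp).const_mul (p x * W.prob x y)
    simpa using this
  have hneg : ∑ x, ∑ y, p x * W.prob x y * (a - Real.log (W.prob x y / W.output p y)) < 0 := by
    simp only [mul_sub, Finset.sum_sub_distrib, ← Finset.sum_mul, ← Finset.mul_sum, W.sum_prob,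
      hp.2, mul_one, one_mul]
    simp only [divergence] at ha
    simp only [mul_assoc, ← Finset.mul_sum]
    linarith
  have hs := hd.tendsto_slope_zero_right
  obtain ⟨t, h1, h2⟩ := ((hs.eventually_lt_const hneg).and self_mem_nhdsWithin).exists
  refine ⟨t, h2, ?_⟩
  simp only [zero_add, h0, smul_eq_mul] at h1
  have : 0 < t := h2
  have h3 : φ t - 1 < 0 := by
    rcases mul_neg_iff.mp h1 with h | h
    · exact h.2
    · exact absurd (inv_pos.mpr this) (not_lt.mpr h.1.le)
  linarith

open Classical in
/-- Chernoff's bound: for `a < I(X:Y)` (in nats) the probability that the information density of a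
block is at most `a r` decays exponentially in `r`. -/
theorem exists_sum_atypical_le (hp : p ∈ stdSimplex ℝ B) {a : ℝ}
    (ha : a < ∑ x, p x * W.divergence x (W.output p)) :
    ∃ ρ : ℝ, 0 ≤ ρ ∧ ρ < 1 ∧ ∀ r : ℕ, ∑ x, ∑ z,
      (if Real.exp (a * r) * (W.block r).output (fun x => ∏ i, p (x i)) z < (W.block r).prob x z
        then 0 else (∏ i, p (x i)) * (W.block r).prob x z) ≤ ρ ^ r := by
  obtain ⟨t, ht, hlt⟩ := W.exists_exp_moment_lt_one hp ha
  set u : B × Y → ℝ := fun w => p w.1 * W.prob w.1 w.2 *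
      Real.exp (t * (a - Real.log (W.prob w.1 w.2 / W.output p w.2))) with hu
  have hu0 : ∀ w, 0 ≤ u w := fun w =>
    mul_nonneg (mul_nonneg (hp.1 _) (W.prob_nonneg _ _)) (Real.exp_pos _).le
  refine ⟨∑ w, u w, Finset.sum_nonneg fun w _ => hu0 w, ?_, fun r => ?_⟩
  · rwa [Fintype.sum_prod_type]
  have hpow : (∑ w, u w) ^ r = ∑ x : Fin r → B, ∑ z : Fin r → Y, ∏ i, u (x i, z i) := by
    have h1 : ∀ x : Fin r → B, ∑ z : Fin r → Y, ∏ i, u (x i, z i) = ∏ i, ∑ y, u (x i, y) :=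
      fun x => sum_pi_prod_eq_prod_sum fun i y => u (x i, y)
    simp only [h1]
    rw [sum_pi_prod_eq_prod_sum fun _ x => ∑ y, u (x, y), Fintype.sum_prod_type]
    simp
  rw [hpow]
  refine Finset.sum_le_sum fun x _ => Finset.sum_le_sum fun z _ => ?_
  have hprod : 0 ≤ ∏ i, u (x i, z i) := Finset.prod_nonneg fun i _ => hu0 _
  split_ifs with hc
  · exact hprod
  rcases (mul_nonneg ((prod_mem_stdSimplex hp r).1 x) ((W.block r).prob_nonneg x z)).eq_or_lt
    with h0 | h0
  · rw [← h0]; exact hprod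
  have hne := mul_ne_zero_iff.mp h0.ne'
  have hW := W.prob_pos_of_block_prob_ne_zero hne.2
  have hP : ∀ i, 0 < p (x i) := fun i =>
    (hp.1 _).lt_of_ne' (Finset.prod_ne_zero_iff.mp hne.1 i (Finset.mem_univ i))
  have hQ : ∀ i, 0 < W.output p (z i) := fun i =>
    (mul_pos (hP i) (hW i)).trans_le (W.mul_prob_le_output hp _ _)
  have hlog : ∑ i, Real.log (W.prob (x i) (z i) / W.output p (z i)) ≤ a * r := by
    rw [not_lt, output_block] at hc
    have h1 : ∏ i, (W.prob (x i) (z i) / W.output p (z i)) ≤ Real.exp (a * r) := by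
      rw [Finset.prod_div_distrib, div_le_iff₀ (Finset.prod_pos fun i _ => hQ i)]
      exact hc
    rw [← Real.log_prod fun i _ => (div_pos (hW i) (hQ i)).ne']
    exact (Real.log_le_iff_le_exp (Finset.prod_pos fun i _ => div_pos (hW i) (hQ i))).mpr h1
  have hfac : ∏ i, u (x i, z i) = (∏ i, p (x i)) * (W.block r).prob x z *
      Real.exp (t * (a * r - ∑ i, Real.log (W.prob (x i) (z i) / W.output p (z i)))) := by
    simp only [hu, Finset.prod_mul_distrib, ← Real.exp_sum, ← Finset.mul_sum,
      Finset.sum_sub_distrib]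
    simp [block, blockProb, mul_comm]
  rw [hfac]
  refine le_mul_of_one_le_right h0.le (Real.one_le_exp ?_)
  exact mul_nonneg ht.le (by linarith)

/-- At rates up to `a` below the capacity there are, for all large block lengths, codes with small
maximal error. -/
theorem exists_blockCode_errorProb_lt [Nonempty B] {a b ε : ℝ} (hab : a < b)
    (hb : b < W.capacity) (hε : 0 < ε) :
    ∃ r₀ : ℕ, ∀ r : ℕ, r₀ ≤ r → ∀ m : ℕ, m * Real.logb 2 (Fintype.card B) ≤ r * a →
      ∃ c : BlockCode B Y m r, ∀ s : Fin m → B, c.errorProb W s < ε := by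
  classical
  obtain ⟨p, hp, hC⟩ := W.isGreatest_capacity.1
  have h2 : 0 < Real.log 2 := Real.log_pos one_lt_two
  have hb' : b * Real.log 2 < ∑ x, p x * W.divergence x (W.output p) := by
    rw [← W.mutualInformation_joint_mul_log_two hp]
    exact mul_lt_mul_of_pos_right (hb.trans_eq hC.symm) h2
  obtain ⟨ρ, hρ0, hρ1, hρ⟩ := W.exists_sum_atypical_le hp hb'
  set σ : ℝ := Real.exp ((a - b) * Real.log 2) with hσ
  have hσ1 : σ < 1 := by
    rw [hσ, ← Real.exp_zero, Real.exp_lt_exp]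
    exact mul_neg_of_neg_of_pos (by linarith) h2
  have hlim : Filter.Tendsto (fun r : ℕ => ρ ^ r + σ ^ r) Filter.atTop (nhds (0 + 0)) :=
    (tendsto_pow_atTop_nhds_zero_of_lt_one hρ0 hρ1).add
      (tendsto_pow_atTop_nhds_zero_of_lt_one (Real.exp_pos _).le hσ1)
  rw [add_zero] at hlim
  obtain ⟨r₀, hr₀⟩ := Filter.eventually_atTop.mp (hlim.eventually_lt_const hε)
  refine ⟨r₀, fun r hr m hm => ?_⟩
  have hk : (0 : ℝ) < Fintype.card B := by exact_mod_cast Fintype.card_pos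
  have hM : ((Finset.univ : Finset (Fin m → B)).card : ℝ) / Real.exp (b * Real.log 2 * r) ≤
      σ ^ r := by
    have h1 : ((Finset.univ : Finset (Fin m → B)).card : ℝ) =
        Real.exp (m * Real.log (Fintype.card B)) := by
      rw [← Real.log_pow, Real.exp_log (by positivity)]
      simp
    rw [h1, hσ, ← Real.exp_nat_mul, ← Real.exp_sub, Real.exp_le_exp]
    rw [Real.logb, ← mul_div_assoc, div_le_iff₀ h2] at hm
    linarith
  obtain ⟨enc, dec, -, herr⟩ := (W.block r).exists_code_of_sum_le (prod_mem_stdSimplex hp r)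
    (Real.exp_pos (b * Real.log 2 * r)) (Finset.univ : Finset (Fin m → B))
    (add_le_add (hρ r) hM)
  -- outputs claimed by no codeword may be decoded arbitrarily
  refine ⟨⟨enc, fun z => (dec z).getD fun _ => Classical.arbitrary B⟩, fun s => ?_⟩
  refine lt_of_le_of_lt ?_ ((herr s (Finset.mem_univ s)).trans_lt (hr₀ r hr))
  refine Finset.sum_le_sum fun z _ => ?_
  by_cases hz : dec z = some s
  · simp [hz]
  · simp only [hz, if_false]
    split_ifs
    · exact (W.block r).prob_nonneg _ _
    · exact le_rfl

theorem achievability [Nonempty B] {R : ℝ} (hR : 0 ≤ R) (hRC : R ≤ W.capacity) {ε : ℝ}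
    (hε : 0 < ε) {δ : ℝ} (hδ : 0 < δ) :
    ∃ r₀ : ℕ, ∀ r : ℕ, r₀ ≤ r → ∃ m : ℕ, m < r ∧ |codeRate B m r - R| < δ ∧
      ∃ c : BlockCode B Y m r, ∀ s : Fin m → B, c.errorProb W s < ε := by
  rcases le_or_gt R (δ / 2) with hsmall | hbig
  · -- a code with a single message has rate `0` and never fails
    refine ⟨1, fun r hr => ⟨0, hr, ?_, ⟨fun _ _ => Classical.arbitrary B, fun _ => Fin.elim0⟩,
      fun s => ?_⟩⟩
    · rw [abs_lt]; simp only [codeRate, Nat.cast_zero, zero_div, zero_mul]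
      constructor <;> linarith
    · have : ∀ f : Fin 0 → B, f = s := fun f => Subsingleton.elim f s
      simp [BlockCode.errorProb, this, hε]
  set L := Real.logb 2 (Fintype.card B) with hL
  obtain ⟨p, hp, hC⟩ := W.isGreatest_capacity.1
  have hCL : W.capacity ≤ L := hC ▸ W.mutualInformation_joint_le hp
  have hLpos : 0 < L := by linarith
  obtain ⟨r₀, hr₀⟩ := W.exists_blockCode_errorProb_lt (a := R - δ / 2) (b := R - δ / 4)
    (by linarith) (by linarith) hε
  obtain ⟨n, hn⟩ := exists_nat_gt (2 * L / δ)
  refine ⟨max r₀ (max n 1), fun r hr => ?_⟩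
  have hr1 : 1 ≤ r := (le_max_right n 1).trans ((le_max_right _ _).trans hr)
  have hrn : n ≤ r := (le_max_left n 1).trans ((le_max_right _ _).trans hr)
  have hrpos : (0 : ℝ) < r := by exact_mod_cast hr1
  have hnr : 2 * L / δ < r := hn.trans_le (by exact_mod_cast hrn)
  rw [div_lt_iff₀ hδ] at hnr
  set v : ℝ := r * (R - δ / 2) / L with hv
  have hv0 : 0 ≤ v := div_nonneg (mul_nonneg hrpos.le (by linarith)) hLpos.le
  have hvL : v * L = r * (R - δ / 2) := by rw [hv]; field_simp
  have hm1 : (⌊v⌋₊ : ℝ) * L ≤ r * (R - δ / 2) :=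
    hvL ▸ mul_le_mul_of_nonneg_right (Nat.floor_le hv0) hLpos.le
  have hm2 : r * (R - δ / 2) < (⌊v⌋₊ + 1 : ℝ) * L :=
    hvL ▸ mul_lt_mul_of_pos_right (Nat.lt_floor_add_one v) hLpos
  refine ⟨⌊v⌋₊, ?_, ?_, hr₀ r ((le_max_left _ _).trans hr) _ hm1⟩
  · have : (⌊v⌋₊ : ℝ) * L < r * L :=
      hm1.trans_lt (mul_lt_mul_of_pos_left (by linarith) hrpos)
    exact_mod_cast lt_of_mul_lt_mul_right this hLpos.le
  · have e : codeRate B ⌊v⌋₊ r = ⌊v⌋₊ * L / r := by rw [codeRate, ← hL]; ring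
    rw [e, abs_lt]
    constructor
    · rw [lt_sub_iff_add_lt, lt_div_iff₀ hrpos]
      nlinarith
    · rw [sub_lt_iff_lt_add, div_lt_iff₀ hrpos]
      nlinarith

/-! ### The converse -/

open Classical in
/-- If no input symbol is farther than `K` nats from `q`, the codewords of a block code are at most
`K r` from the product distribution of `q`. Testing this against the decoder, which succeeds with
probability at most `1 / |B| ^ m` under the product distribution, bounds the number of messages.
The parameter `η` is the weight given to decoding failures. -/
theorem log_card_le_of_divergence_le [Nonempty B] {q : Y → ℝ} (hq : ∀ y, 0 ≤ q y)
    (hq1 : ∑ y, q y = 1) (hac : ∀ x y, 0 < W.prob x y → 0 < q y) {K : ℝ}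
    (hK : ∀ x, W.divergence x q ≤ K) {m r : ℕ} (c : BlockCode B Y m r) {η : ℝ} (hη : 0 < η) :
    (1 - c.averageErrorProb W) * (m * Real.log (Fintype.card B)) +
      c.averageErrorProb W * Real.log η - η ≤ r * K := by
  have hk : (0 : ℝ) < Fintype.card B := by exact_mod_cast Fintype.card_pos
  set M : ℝ := (Fintype.card B : ℝ) ^ m with hM
  have hMpos : 0 < M := by positivity
  set Q : (Fin r → Y) → ℝ := fun z => ∏ i, q (z i) with hQ
  have hQ0 : ∀ z, 0 ≤ Q z := fun z => Finset.prod_nonneg fun i _ => hq _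
  have hQ1 : ∑ z, Q z = 1 := by
    rw [hQ, sum_pi_prod_eq_prod_sum (fun (_ : Fin r) y => q y)]; simp [hq1]
  have hdiv : ∀ x : Fin r → B,
      ∑ z, (W.block r).prob x z * Real.log ((W.block r).prob x z / Q z) ≤ r * K := by
    intro x
    have h1 : ∀ z, (W.block r).prob x z * Real.log ((W.block r).prob x z / Q z) =
        ∑ j, (∏ i, W.prob (x i) (z i)) * Real.log (W.prob (x j) (z j) / q (z j)) := by
      intro z
      rw [← Finset.mul_sum]
      change (∏ i, W.prob (x i) (z i)) * Real.log ((∏ i, W.prob (x i) (z i)) / ∏ i, q (z i)) = _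
      by_cases h0 : ∏ i, W.prob (x i) (z i) = 0
      · simp [h0]
      · have hW := W.prob_pos_of_block_prob_ne_zero h0
        rw [← Finset.prod_div_distrib,
          Real.log_prod fun i _ => (div_pos (hW i) (hac _ _ (hW i))).ne']
    simp only [h1]
    rw [Finset.sum_comm]
    calc ∑ j, ∑ z : Fin r → Y, (∏ i, W.prob (x i) (z i)) *
          Real.log (W.prob (x j) (z j) / q (z j))
        = ∑ j, W.divergence (x j) q := Finset.sum_congr rfl fun j _ =>
          sum_pi_prod_mul_apply (fun i y => W.prob (x i) y) (fun i => W.sum_prob _) j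
            (fun y => Real.log (W.prob (x j) y / q y))
      _ ≤ ∑ _j : Fin r, K := Finset.sum_le_sum fun j _ => hK _
      _ = r * K := by simp
  -- `Q` reweighted by `M` where the decoder returns `s` and by `η` elsewhere
  have hpt : ∀ s z, (W.block r).prob (c.encode s) z - (if c.decode z = s then M else η) * Q z +
      (W.block r).prob (c.encode s) z * Real.log (if c.decode z = s then M else η) ≤
      (W.block r).prob (c.encode s) z * Real.log ((W.block r).prob (c.encode s) z / Q z) := by
    intro s z
    have hg : 0 < (if c.decode z = s then M else η) := by split_ifs <;> assumption
    have hpos : 0 < (W.block r).prob (c.encode s) z → 0 < Q z := by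
      intro h
      exact Finset.prod_pos fun i _ => hac _ _ (W.prob_pos_of_block_prob_ne_zero h.ne' i)
    have h1 := mul_log_div_ge ((W.block r).prob_nonneg (c.encode s) z)
      (mul_nonneg hg.le (hQ0 z)) (fun h => mul_pos hg (hpos h))
    rcases ((W.block r).prob_nonneg (c.encode s) z).eq_or_lt with h0 | h0
    · rw [← h0] at h1 ⊢
      simpa using h1
    · have := hpos h0
      rw [Real.log_div h0.ne' (mul_pos hg this).ne', Real.log_mul hg.ne' this.ne'] at h1
      rw [Real.log_div h0.ne' this.ne']
      linarith
  have hone : ∀ s, 1 - (M * ∑ z, (if c.decode z = s then Q z else 0)) - η +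
      (Real.log M + c.errorProb W s * (Real.log η - Real.log M)) ≤ r * K := by
    intro s
    refine le_trans ?_ (hdiv (c.encode s))
    refine le_trans ?_ (Finset.sum_le_sum fun z _ => hpt s z)
    rw [Finset.sum_add_distrib, Finset.sum_sub_distrib, (W.block r).sum_prob]
    have h1 : ∑ z, (if c.decode z = s then M else η) * Q z ≤
        M * ∑ z, (if c.decode z = s then Q z else 0) + η := by
      calc ∑ z, (if c.decode z = s then M else η) * Q z
          ≤ ∑ z, (M * (if c.decode z = s then Q z else 0) + η * Q z) := by
            refine Finset.sum_le_sum fun z _ => ?_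
            have := mul_nonneg hη.le (hQ0 z)
            split_ifs <;> simp [this]
        _ = _ := by rw [Finset.sum_add_distrib, ← Finset.mul_sum, ← Finset.mul_sum, hQ1, mul_one]
    have h2 : ∑ z, (W.block r).prob (c.encode s) z * Real.log (if c.decode z = s then M else η) =
        Real.log M + c.errorProb W s * (Real.log η - Real.log M) := by
      have e : Real.log M = ∑ z, (W.block r).prob (c.encode s) z * Real.log M := by
        rw [← Finset.sum_mul, (W.block r).sum_prob, one_mul]
      rw [BlockCode.errorProb, Finset.sum_mul]
      nth_rw 1 [e]
      rw [← Finset.sum_add_distrib]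
      refine Finset.sum_congr rfl fun z _ => ?_
      split_ifs
      · simp
      · change _ = (W.block r).prob (c.encode s) z * Real.log M +
          (W.block r).prob (c.encode s) z * (Real.log η - Real.log M)
        ring
    linarith
  have hsum := Finset.sum_le_sum fun s (_ : s ∈ Finset.univ) => hone s
  have hcard : ∑ _s : Fin m → B, (1 : ℝ) = M := by simp [hM]
  have hdec : ∑ s, ∑ z, (if c.decode z = s then Q z else 0) = 1 := by
    rw [Finset.sum_comm]; simp [hQ1]
  have herr : ∑ s, c.errorProb W s = c.averageErrorProb W * M := by
    rw [BlockCode.averageErrorProb, ← hM, div_mul_cancel₀ _ hMpos.ne']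
  have hconst : ∀ a : ℝ, ∑ _s : Fin m → B, a = M * a := fun a => by
    rw [← hcard, Finset.sum_mul]; simp
  rw [Finset.sum_add_distrib, Finset.sum_add_distrib, Finset.sum_sub_distrib,
    Finset.sum_sub_distrib, ← Finset.mul_sum, hdec, ← Finset.sum_mul, herr, hconst, hconst, hconst,
    hconst] at hsum
  have hlogM : Real.log M = m * Real.log (Fintype.card B) := Real.log_pow _ _
  rw [hlogM] at hsum
  refine le_of_mul_le_mul_left ?_ hMpos
  linarith

theorem averageErrorProb_nonneg {m r : ℕ} (c : BlockCode B Y m r) :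
    0 ≤ c.averageErrorProb W := by
  refine div_nonneg (Finset.sum_nonneg fun s _ => Finset.sum_nonneg fun z _ => ?_) (by positivity)
  split_ifs
  · exact le_rfl
  · exact (W.block r).prob_nonneg _ _

theorem converse [Nonempty B] {R : ℝ}
    (h : ∀ ε : ℝ, 0 < ε → ∀ δ : ℝ, 0 < δ → ∃ m r : ℕ, 0 < r ∧ R - δ < codeRate B m r ∧
      ∃ c : BlockCode B Y m r, c.averageErrorProb W < ε) : R ≤ W.capacity := by
  obtain ⟨p, hp, hC⟩ := W.isGreatest_capacity.1
  have h2 : 0 < Real.log 2 := Real.log_pos one_lt_two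
  refine le_of_mul_le_mul_right (le_of_forall_pos_le_add fun η hη => ?_) h2
  -- a weight of at most `1` makes `log η'` nonpositive, so that `e log η'` decreases in the error
  set η' := min η 1 with hη'
  have hη'0 : 0 < η' := lt_min hη one_pos
  have hlog : Real.log η' ≤ 0 := Real.log_nonpos hη'0.le (min_le_right _ _)
  have key : ∀ ε : ℝ, 0 < ε → ε < 1 →
      (1 - ε) * ((R - ε) * Real.log 2) + ε * Real.log η' - η ≤ W.capacity * Real.log 2 := by
    intro ε hε hε1
    obtain ⟨m, r, hr, hrate, c, hc⟩ := h ε hε ε hε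
    have hc0 := W.averageErrorProb_nonneg c
    have hr' : (1 : ℝ) ≤ r := by exact_mod_cast hr
    have hcap := W.log_card_le_of_divergence_le (W.output_nonneg hp) (W.sum_output hp)
      (fun x y => W.output_pos_of_prob_pos hp hC)
      (fun x => W.divergence_output_le_capacity hp hC x) c hη'0
    set L := Real.log (Fintype.card B) with hL
    have hL0 : 0 ≤ L := Real.log_natCast_nonneg _
    have hrate' : (R - ε) * Real.log 2 * r ≤ m * L := by
      have h1 : codeRate B m r * Real.log 2 * r = m * L := by
        rw [codeRate, Real.logb, ← hL]; field_simp
      rw [← h1]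
      gcongr
    have h3 : (1 - ε) * (m * L) ≤ (1 - c.averageErrorProb W) * (m * L) :=
      mul_le_mul_of_nonneg_right (by linarith) (by positivity)
    have h4 : ε * Real.log η' ≤ c.averageErrorProb W * Real.log η' :=
      mul_le_mul_of_nonpos_right hc.le hlog
    have h5 : (1 - ε) * ((R - ε) * Real.log 2 * r) ≤ (1 - ε) * (m * L) :=
      mul_le_mul_of_nonneg_left hrate' (by linarith)
    have h6 : (ε * Real.log η' - η) * r ≤ ε * Real.log η' - η' := by
      have h7 : ε * Real.log η' ≤ 0 := mul_nonpos_of_nonneg_of_nonpos hε.le hlog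
      have h8 : η' ≤ η := min_le_left _ _
      nlinarith
    refine le_of_mul_le_mul_right ?_ (by linarith : (0 : ℝ) < r)
    linarith
  have hlim : Filter.Tendsto (fun ε : ℝ => (1 - ε) * ((R - ε) * Real.log 2) + ε * Real.log η' - η)
      (nhdsWithin 0 (Set.Ioi 0)) (nhds (R * Real.log 2 - η)) := by
    have hcont : Continuous fun ε : ℝ =>
      (1 - ε) * ((R - ε) * Real.log 2) + ε * Real.log η' - η := by fun_prop
    simpa using (hcont.tendsto 0).mono_left (nhdsWithin_le_nhds (s := Set.Ioi 0))
  have := le_of_tendsto hlim (by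
    filter_upwards [Ioo_mem_nhdsGT (zero_lt_one (α := ℝ))] with ε hε
    exact key ε hε.1 hε.2)
  linarith

end MemorylessChannel

/-! ### The coding theorem -/

theorem mainTheorem2 {B Y : Type*} [Fintype B] [Nonempty B] [Fintype Y]
    (W : MemorylessChannel B Y) :
    -- the capacity is an attained maximum of the mutual information
    IsGreatest W.informationValues W.capacity ∧
    -- achievability
    (∀ R : ℝ, 0 ≤ R → R ≤ W.capacity → ∀ ε : ℝ, 0 < ε → ∀ δ : ℝ, 0 < δ →
      ∃ r₀ : ℕ, ∀ r : ℕ, r₀ ≤ r → ∃ m : ℕ, m < r ∧ |codeRate B m r - R| < δ ∧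
        ∃ c : BlockCode B Y m r, ∀ s : Fin m → B, c.errorProb W s < ε) ∧
    -- converse
    (∀ R : ℝ,
      (∀ ε : ℝ, 0 < ε → ∀ δ : ℝ, 0 < δ →
        ∃ m r : ℕ, 0 < r ∧ R - δ < codeRate B m r ∧
          ∃ c : BlockCode B Y m r, c.averageErrorProb W < ε) →
      R ≤ W.capacity) :=
  ⟨W.isGreatest_capacity, fun _ h0 hC _ hε _ hδ => W.achievability h0 hC hε hδ,
    fun _ h => W.converse h⟩
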